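/- Let $\alpha,\beta,\gamma:\mathbb Z_4\to\mathbb Z_2$ be the maps sending $0,1,2,3$ to $0,1,0,1$, to $0,0,1,1$ and to $0,1,1,0$ respectively (so $c=\alpha(c)+2\beta(c)$ and $\gamma=\alpha+\beta$), and let the Gray map be $\phi:\mathbb Z_4^n\to\mathbb Z_2^{2n}$, $\phi(c)=(\beta(c),\gamma(c))$, with $\beta,\gamma$ applied coordinatewise. A binary code is called $\mathbb Z_4$-linear if its coordinates can be arranged so that it is the image $\phi(\mathcal C)$ of a quaternary code $\mathcal C$, i.e. of an additive subgroup $\mathcal C\subseteq\mathbb Z_4^n$ for some $n$. Let $G$ be the binary Golay code, with coordinates indexed by $\mathbb Z/23\cup\{\infty\}$: the $\mathbb Z_2$-linear span of the all-one word and of the characteristic vectors of the 23 sets $\{a+t : t=0 \text{ or } t \text{ is a quadratic non-residue mod } 23\}$, $a\in\mathbb Z/23$. **Theorem.** $G$ is a linear $[24,12,8]$ code (length $24$, dimension $12$, minimum Hamming distance $8$), and $G$ is not $\mathbb Z_4$-linear, under any arrangement of its coordinates. Moreover, whichever binary linear $[24,12,8]$ code is taken as the Golay code, it is not $\mathbb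 Z_4$-linear: no binary linear $[24,12,8]$ code is. -/

import Mathlib

/-- The second bit `β` of the 2-adic expansion `c = α(c) + 2 β(c)` of `c ∈ ℤ/4`:
`0, 1, 2, 3 ↦ 0, 0, 1, 1`. -/
def grayBeta (c : ZMod 4) : ZMod 2 := if c = 2 ∨ c = 3 then 1 else 0

/-- The map `γ = α + β`: `0, 1, 2, 3 ↦ 0, 1, 1, 0`. -/
def grayGamma (c : ZMod 4) : ZMod 2 := if c = 1 ∨ c = 2 then 1 else 0

/-- The Gray map `φ(c) = (β(c), γ(c))` from `(ℤ/4)^n` to `(ℤ/2)^(2n)`. The `2n` binary coordinates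
are the left half (`Sum.inl i`) followed by the right half (`Sum.inr i`). -/
def grayMap {n : ℕ} (c : Fin n → ZMod 4) : Fin n ⊕ Fin n → ZMod 2 :=
  Sum.elim (fun i => grayBeta (c i)) (fun i => grayGamma (c i))

/-- A binary code (an arbitrary set of binary words, with coordinates indexed by `ι`) is
`ℤ₄`-linear if its coordinates can be arranged so that it is the image under the Gray map of a
quaternary code, that is, of an additive subgroup of `(ℤ/4)^n` for some `n`. -/
def IsZ4Linear {ι : Type*} (C : Set (ι → ZMod 2)) : Prop :=
  ∃ (n : ℕ) (e : ι ≃ Fin n ⊕ Fin n) (Q : AddSubgroup (Fin n → ZMod 4)),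
    (fun x : ι → ZMod 2 => x ∘ e.symm) '' C = grayMap '' (Q : Set (Fin n → ZMod 4))

/-- `C` is a binary linear `[n, k, d]` code: length `n`, dimension `k`, minimum distance `d`. -/
def IsBinaryLinearCode {ι : Type*} [Fintype ι] (C : Submodule (ZMod 2) (ι → ZMod 2))
    (n k d : ℕ) : Prop :=
  Fintype.card ι = n ∧ Module.finrank (ZMod 2) C = k ∧
    IsLeast {r : ℕ | ∃ x ∈ C, ∃ y ∈ C, x ≠ y ∧ hammingDist x y = r} d

open Classical in
/-- The binary word on the projective line `ℤ/23 ∪ {∞}` (with `none` as `∞`) that is the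
characteristic vector of `{a + t : t = 0 or t is a quadratic non-residue mod 23}`. -/
noncomputable def golayWord (a : ZMod 23) : Option (ZMod 23) → ZMod 2
  | none => 0
  | some x => if x = a ∨ ¬ IsSquare (x - a) then 1 else 0

/-- The (extended) binary Golay code, as the extended quadratic residue code of length 24: the
span of the all-one word and of the 23 translates of the characteristic vector of zero together
with the quadratic non-residues mod 23. -/
noncomputable def golayCode : Submodule (ZMod 2) (Option (ZMod 23) → ZMod 2) :=
  Submodule.span (ZMod 2) (insert 1 (Set.range golayWord))

/-!
Let `Q ⊆ (ℤ/4)^12` have a Gray image that is a linear `[24, 12, 8]` code. Let `A` be the residue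
code `Q mod 2` and `B = {x | 2x ∈ Q}` the torsion code, so that `|A| |B| = |Q| = 2^12`
(`card_residueCode_mul_card_torsionCode`). Since `φ(u) + φ(v) = φ(u + v + 2uv)`, linearity of the
Gray image puts all coordinatewise products of words of `A` into `B` (`mul_mem_torsionCode`), and
since `φ(2x) = (x, x)`, the nonzero words of `B` have weight at least 4. The sphere-packing bound
`13 |B| ≤ 2^12` forces `|A| ≥ 13`. But a word `a ∈ A` of weight less than 8 splits off: for
`x ∈ A`, the words `ax` and `a(a + x)` of `B` have disjoint supports that cover the support of `a`,
so one of them is zero. By the Plotkin bound this can be done twice, and what remains is too large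
for the remaining coordinates (`card_le_twelve_of_mul_mem`).

The Golay code is self-orthogonal and spanned by words of weight divisible by 4, so all its weights
are divisible by 4. Weight 4 is excluded because each set of four coordinates meets some generator
in an odd number of points (`exists_golayWord_add_ne_zero`), a finite check that translations
reduce to sets containing the coordinate 0. The dimension is at most 12 by self-orthogonality, and
at least 12 because twelve translates of an octad are in echelon form.
-/

/-! ### Binary codes of length 12 closed under products -/

/-- The Plotkin bound for a linear code supported on `S`: the total weight of the nonzero words is
at least `d (|D| - 1)`, and at most `|S| |D| / 2`, since at each coordinate at most half of the
words have a one. -/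
theorem two_mul_mul_card_sub_one_le {ι : Type*} [Fintype ι] (D : AddSubgroup (ι → ZMod 2))
    (S : Finset ι) (hS : ∀ x ∈ D, ∀ i ∉ S, x i = 0) {d : ℕ}
    (hd : ∀ x ∈ D, x ≠ 0 → d ≤ hammingNorm x) :
    2 * (d * (Nat.card D - 1)) ≤ S.card * Nat.card D := by
  have := Fintype.ofFinite D
  have hkey : ∀ p q : ZMod 2, p ≠ 0 → q ≠ 0 → ¬ p + q ≠ 0 := by decide
  have hcoord (i : ι) : 2 * (Finset.univ.filter fun x : D => x.1 i ≠ 0).card ≤ Nat.card D := by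
    rw [Nat.card_eq_fintype_card, ← Finset.card_univ,
      ← Finset.card_filter_add_card_filter_not (s := Finset.univ) (fun x : D => x.1 i ≠ 0)]
    suffices (Finset.univ.filter fun x : D => x.1 i ≠ 0).card ≤
        (Finset.univ.filter fun x : D => ¬ x.1 i ≠ 0).card by omega
    rcases (Finset.univ.filter fun x : D => x.1 i ≠ 0).eq_empty_or_nonempty with h | ⟨y, hy⟩
    · simp [h]
    · -- translation by a word with a one at `i` exchanges the two halves of the code
      refine Finset.card_le_card_of_injOn (fun x => x + y) ?_ (fun _ _ _ _ h => by simpa using h)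
      intro x hx
      simp only [Finset.coe_filter, Finset.mem_univ, true_and, Set.mem_ofPred_eq,
        Finset.mem_filter] at hx hy ⊢
      exact hkey _ _ hx hy
  have hsum : ∑ x : D, hammingNorm x.1 =
      ∑ i ∈ S, (Finset.univ.filter fun x : D => x.1 i ≠ 0).card := by
    have : ∀ x : D, hammingNorm x.1 = ∑ i ∈ S, if x.1 i ≠ 0 then 1 else 0 := by
      intro x
      rw [hammingNorm, ← Finset.card_filter]
      congr 1
      ext i
      simp only [Finset.mem_filter, Finset.mem_univ, true_and]
      exact ⟨fun h => ⟨by_contra fun hi => h (hS _ x.2 i hi), h⟩, fun h => h.2⟩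
    simp_rw [this, Finset.card_filter]
    exact Finset.sum_comm
  have hlow : d * (Nat.card D - 1) ≤ ∑ x : D, hammingNorm x.1 := by
    classical
    rw [← Finset.sum_erase_add _ _ (Finset.mem_univ (0 : D)), Nat.card_eq_fintype_card,
      ← Finset.card_univ, ← Finset.card_erase_of_mem (Finset.mem_univ (0 : D)), mul_comm]
    refine le_add_right (Finset.card_nsmul_le_sum _ _ _ fun x hx => hd x.1 x.2 ?_)
    simpa using hx
  calc 2 * (d * (Nat.card D - 1)) ≤ 2 * ∑ x : D, hammingNorm x.1 := by gcongr
    _ = ∑ i ∈ S, 2 * (Finset.univ.filter fun x : D => x.1 i ≠ 0).card := by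
      rw [hsum, Finset.mul_sum]
    _ ≤ S.card * Nat.card D := by
      simpa using Finset.sum_le_card_nsmul _ _ _ fun i _ => hcoord i

/-- The sphere-packing bound for radius 1. -/
theorem card_mul_card_add_one_le {ι : Type*} [Fintype ι] (B : AddSubgroup (ι → ZMod 2))
    (hB : ∀ x ∈ B, x ≠ 0 → 3 ≤ hammingNorm x) :
    Nat.card B * (Fintype.card ι + 1) ≤ 2 ^ Fintype.card ι := by
  classical
  -- the words of weight at most 1
  let s : Option ι → ι → ZMod 2 := fun o => o.elim 0 fun i => Pi.single i 1
  have hs (o : Option ι) : hammingNorm (s o) ≤ 1 := by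
    cases o with
    | none => simp [s]
    | some i =>
      refine Finset.card_le_one.2 fun j hj k hk => ?_
      simp only [s, Option.elim_some, Finset.mem_filter, Finset.mem_univ, true_and,
        Pi.single_apply, ne_eq, ite_eq_right_iff, not_forall] at hj hk
      rw [hj.1, hk.1]
  have hsinj : Function.Injective s := by
    rintro (_ | i) (_ | j) h
    · rfl
    · simpa [s] using (congrFun h j).symm
    · simpa [s] using congrFun h i
    · have := congrFun h i
      simp only [s, Option.elim_some, Pi.single_eq_same] at this
      rw [Pi.single_apply] at this
      split_ifs at this with hij
      · rw [hij]
      · simp at this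
  have hinj : Function.Injective fun p : B × Option ι => p.1.1 + s p.2 := by
    rintro ⟨b, o⟩ ⟨b', o'⟩ h
    have h1 : (b - b').1 = s o' - s o := by
      simp only [AddSubgroup.coe_sub]
      linear_combination (exp := 1) h
    have h2 : hammingNorm (b - b').1 ≤ 2 := by
      rw [h1, sub_eq_neg_add, ← hammingDist_eq_hammingNorm]
      have := hammingDist_triangle (s o) 0 (s o')
      rw [hammingDist_zero_left, hammingDist_zero_right] at this
      have := hs o; have := hs o'; omega
    have h3 : (b - b').1 = 0 := by
      by_contra hne
      have := hB _ (b - b').2 hne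
      omega
    have h4 : b = b' := by
      rw [← sub_eq_zero]; exact Subtype.ext h3
    subst h4
    have h5 : o = o' := hsinj (by simpa using h)
    rw [h5]
  have := Nat.card_le_card_of_injective _ hinj
  simpa [Nat.card_prod] using this

theorem hammingNorm_mul_add_hammingNorm_add_mul {ι : Type*} [Fintype ι] (a b : ι → ZMod 2) :
    hammingNorm (a * b) + hammingNorm (a + a * b) = hammingNorm a := by
  have hkey : ∀ p q : ZMod 2, ((if p * q ≠ 0 then 1 else 0) + if p + p * q ≠ 0 then 1 else 0) =
      if p ≠ 0 then 1 else 0 := by decide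
  simp only [hammingNorm, Finset.card_filter, ← Finset.sum_add_distrib, Pi.mul_apply,
    Pi.add_apply]
  exact Finset.sum_congr rfl fun i _ => hkey _ _

/-- The words of `D` whose support is disjoint from that of `a`. -/
def AddSubgroup.disjointWords {ι : Type*} (D : AddSubgroup (ι → ZMod 2)) (a : ι → ZMod 2) :
    AddSubgroup (ι → ZMod 2) :=
  D ⊓ (AddMonoidHom.mulLeft a).ker

theorem AddSubgroup.mem_disjointWords {ι : Type*} {D : AddSubgroup (ι → ZMod 2)}
    {a x : ι → ZMod 2} : x ∈ D.disjointWords a ↔ x ∈ D ∧ a * x = 0 := Iff.rfl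

theorem AddSubgroup.card_le_two_mul_card_disjointWords {ι : Type*} [Fintype ι]
    (D : AddSubgroup (ι → ZMod 2)) (a : ι → ZMod 2) (h : ∀ x ∈ D, a * x = 0 ∨ a * x = a) :
    Nat.card D ≤ 2 * Nat.card (D.disjointWords a) := by
  classical
  let f : D →+ (ι → ZMod 2) := (AddMonoidHom.mulLeft a).comp D.subtype
  have hker : Nat.card f.ker = Nat.card (D.disjointWords a) := by
    refine Nat.card_congr ⟨fun x => ⟨x.1.1, x.1.2, x.2⟩, fun x => ⟨⟨x.1, x.2.1⟩, x.2.2⟩, ?_, ?_⟩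
    · intro x; rfl
    · intro x; rfl
  have hrange : Nat.card f.range ≤ 2 := by
    have hsub : (f.range : Set (ι → ZMod 2)) ⊆ ({0, a} : Set (ι → ZMod 2)) := by
      rintro _ ⟨x, rfl⟩
      exact h x.1 x.2
    calc Nat.card f.range ≤ Set.ncard ({0, a} : Set (ι → ZMod 2)) :=
          Set.ncard_le_ncard hsub (Set.toFinite _)
      _ ≤ 2 := (Set.ncard_insert_le _ _).trans (by rw [Set.ncard_singleton])
  rw [← hker, ← f.ker.index_mul_card, AddSubgroup.index_ker]
  gcongr

/-- A linear code `A` of length 12 whose coordinatewise products lie in a linear code `B` of minimum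
weight at least 4 has fewer than 13 words. Otherwise two words `a`, `b` of weight less than 8 can be split off one after
the other, which leaves at least 4 words supported on the at most 4 coordinates outside `a` and
`b`; the Plotkin bound forbids this. -/
theorem card_le_twelve_of_mul_mem {ι : Type*} [Fintype ι] (hι : Fintype.card ι = 12)
    (A B : AddSubgroup (ι → ZMod 2)) (hAB : ∀ x ∈ A, ∀ y ∈ A, x * y ∈ B)
    (hB : ∀ x ∈ B, x ≠ 0 → 4 ≤ hammingNorm x) : Nat.card A ≤ 12 := by
  by_contra! hcard
  have hsq (x : ι → ZMod 2) : x * x = x := by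
    ext i
    simp only [Pi.mul_apply]
    generalize x i = p
    revert p; decide
  have hself (x : ι → ZMod 2) : x + x = 0 := by
    ext i
    exact CharTwo.add_self_eq_zero _
  have hA (x) (hx : x ∈ A) (h0 : x ≠ 0) : 4 ≤ hammingNorm x :=
    hB x (hsq x ▸ hAB x hx x hx) h0
  have hlight (D : AddSubgroup (ι → ZMod 2)) (hD : 5 ≤ Nat.card D) :
      ∃ a ∈ D, a ≠ 0 ∧ hammingNorm a < 8 := by
    by_contra! h
    have := two_mul_mul_card_sub_one_le D Finset.univ (by simp) h
    rw [Finset.card_univ, hι] at this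
    omega
  -- `a * x` and `a + a * x = a * (a + x)` lie in `B` and their weights add up to that of `a`, so
  -- one of them vanishes
  have hsplit (a) (ha : a ∈ A) (h8 : hammingNorm a < 8) (x) (hx : x ∈ A) :
      a * x = 0 ∨ a * x = a := by
    by_contra! h
    have h1 := hB _ (hAB a ha x hx) h.1
    have h2 : a + a * x ∈ B := by
      have := hAB a ha (a + x) (A.add_mem ha hx)
      rwa [mul_add, hsq] at this
    have h3 := hB _ h2 fun h0 => h.2 (add_left_cancel (h0.trans (hself a).symm))
    have := hammingNorm_mul_add_hammingNorm_add_mul a x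
    omega
  obtain ⟨a, haA, ha0, ha8⟩ := hlight A (by omega)
  have hD₁ := A.card_le_two_mul_card_disjointWords a (hsplit a haA ha8)
  set D₁ := A.disjointWords a
  obtain ⟨b, hbD, hb0, hb8⟩ := hlight D₁ (by omega)
  obtain ⟨hbA, hab⟩ := AddSubgroup.mem_disjointWords.1 hbD
  have hD₂ := D₁.card_le_two_mul_card_disjointWords b
    fun x hx => hsplit b hbA hb8 x hx.1
  have := two_mul_mul_card_sub_one_le (D₁.disjointWords b)
    (Finset.univ.filter fun i => ¬ (a + b) i ≠ 0) ?_ (d := 4) fun x hx => hA x hx.1.1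
  · have hnorm : hammingNorm (a + b) = hammingNorm a + hammingNorm b := by
      have h1 := hammingNorm_mul_add_hammingNorm_add_mul (a + b) a
      have h2 : (a + b) * a = a := by rw [add_mul, hsq, mul_comm b, hab, add_zero]
      have h3 : a + b + a = b := by rw [add_right_comm, hself, zero_add]
      rw [h2, h3] at h1
      exact h1.symm
    have hS := Finset.card_filter_add_card_filter_not (s := (Finset.univ : Finset ι))
      (fun i => (a + b) i ≠ 0)
    rw [Finset.card_univ, hι] at hS
    change hammingNorm (a + b) + _ = 12 at hS
    have h4 := hA a haA ha0
    have h5 := hA b hbA hb0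
    have h6 : (Finset.univ.filter fun i => ¬ (a + b) i ≠ 0).card ≤ 4 := by omega
    have h7 := this.trans (Nat.mul_le_mul_right _ h6)
    omega
  · intro x hx i hi
    have hkey : ∀ p q r : ZMod 2, ¬ p + q = 0 → p * r = 0 → q * r = 0 → r = 0 := by decide
    have hax := congrFun hx.1.2 i
    have hbx := congrFun hx.2 i
    simp only [Finset.mem_filter, Finset.mem_univ, true_and, not_not, Pi.add_apply] at hi
    exact hkey _ _ _ hi hax hbx

/-! ### Quaternary codes with a linear Gray image -/

/-- Multiplication by 2, as the embedding `0, 1 ↦ 0, 2` of `ℤ/2` into `ℤ/4`. -/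
def zmodDouble : ZMod 2 →+ ZMod 4 where
  toFun x := if x = 1 then 2 else 0
  map_zero' := by decide
  map_add' := by decide

theorem zmodDouble_injective : Function.Injective zmodDouble := by
  unfold Function.Injective
  decide

theorem zmodDouble_castHom_mul :
    ∀ u v : ZMod 4, zmodDouble (ZMod.castHom (show 2 ∣ 4 by decide) (ZMod 2) u *
      ZMod.castHom (show 2 ∣ 4 by decide) (ZMod 2) v) = 2 * u * v := by
  decide

theorem exists_zmodDouble_eq : ∀ u : ZMod 4,
    ZMod.castHom (show 2 ∣ 4 by decide) (ZMod 2) u = 0 → ∃ x, zmodDouble x = u := by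
  decide

theorem castHom_zmodDouble : ∀ x : ZMod 2,
    ZMod.castHom (show 2 ∣ 4 by decide) (ZMod 2) (zmodDouble x) = 0 := by
  decide

/-- The binary code of the words `u mod 2`, for `u` in the quaternary code `Q`. -/
def residueCode {n : ℕ} (Q : AddSubgroup (Fin n → ZMod 4)) : AddSubgroup (Fin n → ZMod 2) :=
  Q.map ((ZMod.castHom (show 2 ∣ 4 by decide) (ZMod 2)).toAddMonoidHom.compLeft (Fin n))

/-- The binary code of the words `x` with `2x` in the quaternary code `Q`. -/
def torsionCode {n : ℕ} (Q : AddSubgroup (Fin n → ZMod 4)) : AddSubgroup (Fin n → ZMod 2) :=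
  Q.comap (zmodDouble.compLeft (Fin n))

/-- The words of `Q` that vanish mod 2 are the doubles of those of the torsion code. -/
theorem card_residueCode_mul_card_torsionCode {n : ℕ} (Q : AddSubgroup (Fin n → ZMod 4)) :
    Nat.card (residueCode Q) * Nat.card (torsionCode Q) = Nat.card Q := by
  let f : Q →+ (Fin n → ZMod 2) :=
    ((ZMod.castHom (show 2 ∣ 4 by decide) (ZMod 2)).toAddMonoidHom.compLeft (Fin n)).comp Q.subtype
  have hrange : f.range = residueCode Q := by
    rw [residueCode, AddMonoidHom.range_comp, AddSubgroup.range_subtype]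
  have hker : Nat.card f.ker = Nat.card (torsionCode Q) := by
    symm
    refine Nat.card_congr (Equiv.ofBijective
      (fun x => ⟨⟨fun i => zmodDouble (x.1 i), x.2⟩, ?_⟩) ⟨?_, ?_⟩)
    · ext i
      exact castHom_zmodDouble _
    · intro x y h
      ext i
      exact zmodDouble_injective (congrFun (congrArg (fun z => z.1.1) h) i)
    · rintro ⟨⟨u, hu⟩, h0⟩
      choose x hx using fun i => exists_zmodDouble_eq (u i) (congrFun h0 i)
      obtain rfl : (fun i => zmodDouble (x i)) = u := funext hx
      exact ⟨⟨x, hu⟩, rfl⟩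
  rw [← hrange, ← hker, ← f.ker.index_mul_card, AddSubgroup.index_ker]

theorem grayMap_injective {n : ℕ} : Function.Injective (grayMap (n := n)) := by
  have h : ∀ u v : ZMod 4, grayBeta u = grayBeta v → grayGamma u = grayGamma v → u = v := by
    decide
  exact fun u v huv => funext fun i =>
    h _ _ (congrFun huv (Sum.inl i)) (congrFun huv (Sum.inr i))

theorem grayMap_add_grayMap {n : ℕ} (u v : Fin n → ZMod 4) :
    grayMap u + grayMap v = grayMap (u + v + 2 * u * v) := by
  have hβ : ∀ u v : ZMod 4, grayBeta u + grayBeta v = grayBeta (u + v + 2 * u * v) := by decide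
  have hγ : ∀ u v : ZMod 4, grayGamma u + grayGamma v = grayGamma (u + v + 2 * u * v) := by decide
  ext (i | i)
  · exact hβ _ _
  · exact hγ _ _

theorem grayMap_zmodDouble {n : ℕ} (x : Fin n → ZMod 2) :
    grayMap (zmodDouble.compLeft (Fin n) x) = Sum.elim x x := by
  have hβ : ∀ x : ZMod 2, grayBeta (zmodDouble x) = x := by decide
  have hγ : ∀ x : ZMod 2, grayGamma (zmodDouble x) = x := by decide
  ext (i | i)
  · exact hβ _
  · exact hγ _

/-- If the Gray image of `Q` is closed under addition, then `u + v + 2uv ∈ Q` for `u, v ∈ Q`, so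
`2uv ∈ Q`. -/
theorem mul_mem_torsionCode {n : ℕ} {Q : AddSubgroup (Fin n → ZMod 4)}
    (hQ : ∀ u ∈ Q, ∀ v ∈ Q, ∃ w ∈ Q, grayMap w = grayMap u + grayMap v) {x y : Fin n → ZMod 2}
    (hx : x ∈ residueCode Q) (hy : y ∈ residueCode Q) : x * y ∈ torsionCode Q := by
  obtain ⟨u, hu, rfl⟩ := hx
  obtain ⟨v, hv, rfl⟩ := hy
  obtain ⟨w, hw, hwuv⟩ := hQ u hu v hv
  rw [grayMap_add_grayMap] at hwuv
  rw [grayMap_injective hwuv] at hw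
  have h : 2 * u * v ∈ Q := by
    have := Q.sub_mem hw (Q.add_mem hu hv)
    rwa [add_sub_cancel_left] at this
  have heq : zmodDouble.compLeft (Fin n)
      ((ZMod.castHom (show 2 ∣ 4 by decide) (ZMod 2)).toAddMonoidHom.compLeft (Fin n) u *
       (ZMod.castHom (show 2 ∣ 4 by decide) (ZMod 2)).toAddMonoidHom.compLeft (Fin n) v) =
      2 * u * v := funext fun i => zmodDouble_castHom_mul _ _
  change _ ∈ Q
  rwa [heq]

theorem hammingNorm_sumElim {ι κ : Type*} [Fintype ι] [Fintype κ] (x : ι → ZMod 2)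
    (y : κ → ZMod 2) : hammingNorm (Sum.elim x y) = hammingNorm x + hammingNorm y := by
  simp only [hammingNorm, Finset.card_filter, Fintype.sum_sum_type]
  rfl

theorem hammingNorm_comp_equiv {ι κ : Type*} [Fintype ι] [Fintype κ] (e : κ ≃ ι)
    (x : ι → ZMod 2) : hammingNorm (x ∘ e) = hammingNorm x := by
  simp only [hammingNorm, Finset.card_filter]
  exact e.sum_comp fun i => if x i ≠ 0 then 1 else 0

theorem not_isZ4Linear_of_isBinaryLinearCode {ι : Type*} [Fintype ι]
    (C : Submodule (ZMod 2) (ι → ZMod 2)) (hC : IsBinaryLinearCode C 24 12 8) :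
    ¬ IsZ4Linear (C : Set (ι → ZMod 2)) := by
  rintro ⟨n, e, Q, hQ⟩
  obtain ⟨hι, hdim, hdist⟩ := hC
  obtain rfl : n = 12 := by
    have := Fintype.card_congr e
    simp only [Fintype.card_sum, Fintype.card_fin] at this
    omega
  have hmem (w : Fin 12 ⊕ Fin 12 → ZMod 2) : (∃ u ∈ Q, grayMap u = w) ↔ w ∘ e ∈ C := by
    change w ∈ grayMap '' (Q : Set _) ↔ _
    rw [← hQ]
    constructor
    · rintro ⟨x, hx, rfl⟩
      simpa [Function.comp_assoc] using hx
    · exact fun h => ⟨_, h, by simp [Function.comp_assoc]⟩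
  have hcard : Nat.card Q = 2 ^ 12 := by
    have hC : Nat.card C = 2 ^ 12 := by
      rw [Module.natCard_eq_pow_finrank (K := ZMod 2), hdim, Nat.card_zmod]
    have h := congrArg Set.ncard hQ
    rw [Set.ncard_image_of_injective _ grayMap_injective,
      Set.ncard_image_of_injective _ e.symm.surjective.injective_comp_right] at h
    exact h.symm.trans hC
  have hadd : ∀ u ∈ Q, ∀ v ∈ Q, ∃ w ∈ Q, grayMap w = grayMap u + grayMap v := by
    intro u hu v hv
    rw [hmem]
    exact C.add_mem ((hmem _).1 ⟨u, hu, rfl⟩) ((hmem _).1 ⟨v, hv, rfl⟩)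
  -- the Gray image of `2x` is `(x, x)`, of weight twice that of `x`
  have htor : ∀ x ∈ torsionCode Q, x ≠ 0 → 4 ≤ hammingNorm x := by
    intro x hx hx0
    have h1 : Sum.elim x x ∘ e ∈ C := (hmem _).1 ⟨_, hx, grayMap_zmodDouble x⟩
    have h2 : hammingNorm (Sum.elim x x ∘ e) = hammingNorm x + hammingNorm x := by
      rw [hammingNorm_comp_equiv, hammingNorm_sumElim]
    have h3 : Sum.elim x x ∘ e ≠ 0 := by
      rw [← hammingNorm_pos_iff, h2]
      have := hammingNorm_pos_iff.2 hx0
      omega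
    have h4 := hdist.2 ⟨_, h1, 0, C.zero_mem, h3, rfl⟩
    rw [hammingDist_zero_right, h2] at h4
    omega
  have hA := card_le_twelve_of_mul_mem (Fintype.card_fin 12) (residueCode Q) (torsionCode Q)
    (fun _ hx _ hy => mul_mem_torsionCode hadd hx hy) htor
  have hB := card_mul_card_add_one_le (torsionCode Q)
    fun x hx hx0 => (htor x hx hx0).trans' (by norm_num)
  rw [Fintype.card_fin] at hB
  have hAB := (card_residueCode_mul_card_torsionCode Q).trans hcard
  have := Nat.mul_le_mul_right (Nat.card (torsionCode Q)) hA
  omega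

/-! ### Parameters of the Golay code -/

/-- Computable form of the characteristic function of zero and the quadratic non-residues mod 23:
these are the positions of the ones in the binary expansion of `8047777`. -/
def golayBit (t : ZMod 23) : ZMod 2 := if Nat.testBit 8047777 t.val then 1 else 0

theorem golayWord_none (a : ZMod 23) : golayWord a none = 0 := rfl

theorem golayWord_some (a x : ZMod 23) : golayWord a (some x) = golayBit (x - a) := by
  have h : ∀ t : ZMod 23, (t = 0 ∨ ¬ IsSquare t) ↔ Nat.testBit 8047777 t.val = true := by
    decide +kernel
  simp only [golayWord, golayBit, ← h, sub_eq_zero]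

theorem golayWord_mem (a : ZMod 23) : golayWord a ∈ golayCode :=
  Submodule.subset_span (Or.inr ⟨a, rfl⟩)

theorem one_mem_golayCode : (1 : Option (ZMod 23) → ZMod 2) ∈ golayCode :=
  Submodule.subset_span (Or.inl rfl)

theorem sum_golayBit_sub_mul_golayBit_sub :
    ∀ a b : ZMod 23, ∑ x, golayBit (x - a) * golayBit (x - b) = 0 := by
  decide +kernel

theorem sum_golayBit_sub : ∀ a : ZMod 23, ∑ x, golayBit (x - a) = 0 := by
  decide +kernel

theorem sum_ite_golayBit_sub_ne_zero :
    ∀ a : ZMod 23, ∑ x, (if golayBit (x - a) ≠ 0 then 1 else 0) = 12 := by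
  decide +kernel

theorem exists_golayBit_add_add_ne_zero (i j k : ZMod 23) (hij : i ≠ j) (hik : i ≠ k)
    (hjk : j ≠ k) : ∃ a, golayBit (i - a) + golayBit (j - a) + golayBit (k - a) ≠ 0 := by
  have h : ∀ i j : ZMod 23, i ≠ 0 → j ≠ 0 → i ≠ j →
      ∃ a, golayBit (i - a) + golayBit (j - a) + golayBit (-a) ≠ 0 := by
    decide +kernel
  -- translate the last point to zero
  obtain ⟨a, ha⟩ := h (i - k) (j - k) (sub_ne_zero.2 hik) (sub_ne_zero.2 hjk) (by simpa using hij)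
  refine ⟨a + k, ?_⟩
  convert ha using 4 <;> ring_nf

theorem exists_golayBit_add_add_add_ne_zero (i j k l : ZMod 23) (hij : i ≠ j) (hik : i ≠ k)
    (hil : i ≠ l) (hjk : j ≠ k) (hjl : j ≠ l) (hkl : k ≠ l) :
    ∃ a, golayBit (i - a) + golayBit (j - a) + golayBit (k - a) + golayBit (l - a) ≠ 0 := by
  have h : ∀ i j : ZMod 23, i ≠ 0 → j ≠ 0 → i ≠ j → ∀ k, k ≠ 0 → i ≠ k → j ≠ k →
      ∃ a, golayBit (i - a) + golayBit (j - a) + golayBit (k - a) + golayBit (-a) ≠ 0 := by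
    decide +kernel
  -- translate the last point to zero
  obtain ⟨a, ha⟩ := h (i - l) (j - l) (sub_ne_zero.2 hil) (sub_ne_zero.2 hjl) (by simpa using hij)
    (k - l) (sub_ne_zero.2 hkl) (by simpa using hik) (by simpa using hjk)
  refine ⟨a + l, ?_⟩
  convert ha using 4 <;> ring_nf

/-- Every four-element set of coordinates meets some `golayWord a` in an odd number of points. -/
theorem exists_golayWord_add_ne_zero (i j k l : Option (ZMod 23)) (hij : i ≠ j) (hik : i ≠ k)
    (hil : i ≠ l) (hjk : j ≠ k) (hjl : j ≠ l) (hkl : k ≠ l) :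
    ∃ a, golayWord a i + golayWord a j + golayWord a k + golayWord a l ≠ 0 := by
  have h4 := exists_golayBit_add_add_add_ne_zero
  have h3 := exists_golayBit_add_add_ne_zero
  rcases i with _ | i <;> rcases j with _ | j <;> rcases k with _ | k <;> rcases l with _ | l <;>
    simp_all only [ne_eq, not_true_eq_false, Option.some.injEq, golayWord_none, golayWord_some,
      zero_add, add_zero, not_false_eq_true]

theorem dotProduct_eq_zero_of_mem_golayCode {x y : Option (ZMod 23) → ZMod 2}
    (hx : x ∈ golayCode) (hy : y ∈ golayCode) : x ⬝ᵥ y = 0 := by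
  have hgen : ∀ u ∈ insert 1 (Set.range golayWord), ∀ v ∈ insert 1 (Set.range golayWord),
      u ⬝ᵥ v = 0 := by
    rintro _ (rfl | ⟨a, rfl⟩) _ (rfl | ⟨b, rfl⟩) <;>
      simp [dotProduct, Fintype.sum_option, golayWord_none, golayWord_some, sum_golayBit_sub,
        sum_golayBit_sub_mul_golayBit_sub]
    decide
  have hleft : ∀ u ∈ insert 1 (Set.range golayWord), u ⬝ᵥ y = 0 := by
    intro u hu
    induction hy using Submodule.span_induction with
    | mem v hv => exact hgen u hu v hv
    | zero => exact dotProduct_zero u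
    | add v w _ _ hv hw => rw [dotProduct_add, hv, hw, add_zero]
    | smul c v _ hv => rw [dotProduct_smul, hv, smul_zero]
  induction hx using Submodule.span_induction with
  | mem u hu => exact hleft u hu
  | zero => exact zero_dotProduct y
  | add v w _ _ hv hw => rw [add_dotProduct, hv, hw, add_zero]
  | smul c v _ hv => rw [smul_dotProduct, hv, smul_zero]

theorem hammingNorm_add_add_two_mul {ι : Type*} [Fintype ι] (x y : ι → ZMod 2) :
    hammingNorm (x + y) + 2 * hammingNorm (x * y) = hammingNorm x + hammingNorm y := by
  have hkey : ∀ p q : ZMod 2, ((if p + q ≠ 0 then 1 else 0) + 2 * if p * q ≠ 0 then 1 else 0) =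
      (if p ≠ 0 then 1 else 0) + if q ≠ 0 then 1 else 0 := by decide
  simp only [hammingNorm, Finset.card_filter, Finset.mul_sum, ← Finset.sum_add_distrib]
  exact Finset.sum_congr rfl fun i _ => hkey _ _

theorem natCast_hammingNorm {ι : Type*} [Fintype ι] (x : ι → ZMod 2) :
    (hammingNorm x : ZMod 2) = ∑ i, x i := by
  have hkey : ∀ p : ZMod 2, ((if p ≠ 0 then 1 else 0 : ℕ) : ZMod 2) = p := by decide
  simp only [hammingNorm, Finset.card_filter, Nat.cast_sum]
  exact Finset.sum_congr rfl fun i _ => hkey _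

theorem four_dvd_hammingNorm_of_mem_golayCode {x : Option (ZMod 23) → ZMod 2}
    (hx : x ∈ golayCode) : 4 ∣ hammingNorm x := by
  induction hx using Submodule.span_induction with
  | mem u hu =>
    rcases hu with rfl | ⟨a, rfl⟩
    · simp [hammingNorm]
    · have : hammingNorm (golayWord a) = 12 := by
        rw [hammingNorm, Finset.card_filter, Fintype.sum_option]
        simp only [golayWord_none, golayWord_some, sum_ite_golayBit_sub_ne_zero]
        rfl
      rw [this]; norm_num
  | zero => simp
  | add u v hu hv hu4 hv4 =>
    have h1 := hammingNorm_add_add_two_mul u v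
    have h2 : 2 ∣ hammingNorm (u * v) := by
      rw [← ZMod.natCast_eq_zero_iff, natCast_hammingNorm]
      exact dotProduct_eq_zero_of_mem_golayCode hu hv
    omega
  | smul c u _ hu =>
    obtain rfl | rfl : c = 0 ∨ c = 1 := by revert c; decide
    · simp
    · simpa using hu

/-- A word of weight 4 in the self-orthogonal Golay code would meet every `golayWord a` in an even
number of points. -/
theorem hammingNorm_ne_four_of_mem_golayCode {x : Option (ZMod 23) → ZMod 2}
    (hx : x ∈ golayCode) : hammingNorm x ≠ 4 := by
  intro h
  obtain ⟨i, t, hit, hs, ht⟩ := Finset.card_eq_succ.1 h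
  obtain ⟨j, k, l, hjk, hjl, hkl, rfl⟩ := Finset.card_eq_three.1 ht
  simp only [Finset.mem_insert, Finset.mem_singleton, not_or] at hit
  obtain ⟨a, ha⟩ := exists_golayWord_add_ne_zero i j k l hit.1 hit.2.1 hit.2.2 hjk hjl hkl
  apply ha
  have hdot := dotProduct_eq_zero_of_mem_golayCode hx (golayWord_mem a)
  have hone : ∀ p : ZMod 2, p ≠ 0 → p = 1 := by decide
  rw [dotProduct, ← Finset.sum_filter_of_ne (p := fun i => x i ≠ 0)
    fun i _ hne => left_ne_zero_of_mul hne, ← hs,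
    Finset.sum_congr (g := fun i => golayWord a i) rfl, Finset.sum_insert (by simpa using hit),
    Finset.sum_insert (by simp [hjk, hjl]), Finset.sum_pair hkl] at hdot
  · rw [← hdot]; ring
  · intro m hm
    rw [hs, Finset.mem_filter] at hm
    rw [hone _ hm.2, one_mul]

/-- A Golay codeword of weight 8, supported on `∞` and on `b + {0, 1, 5, 6, 7, 9, 11}`. -/
noncomputable def golayOctad (b : ZMod 23) : Option (ZMod 23) → ZMod 2 :=
  1 + golayWord (b + 10) + golayWord (b + 11) + golayWord (b + 14)

theorem golayOctad_mem (b : ZMod 23) : golayOctad b ∈ golayCode :=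
  golayCode.add_mem (golayCode.add_mem (golayCode.add_mem one_mem_golayCode (golayWord_mem _))
    (golayWord_mem _)) (golayWord_mem _)

theorem golayOctad_some (b x : ZMod 23) : golayOctad b (some x) =
    1 + golayBit (x - (b + 10)) + golayBit (x - (b + 11)) + golayBit (x - (b + 14)) := by
  simp only [golayOctad, Pi.add_apply, Pi.one_apply, golayWord_some]

theorem hammingNorm_golayOctad (b : ZMod 23) : hammingNorm (golayOctad b) = 8 := by
  have h : ∀ b : ZMod 23, ∑ x, (if 1 + golayBit (x - (b + 10)) + golayBit (x - (b + 11)) +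
      golayBit (x - (b + 14)) ≠ 0 then 1 else 0) = 7 := by decide +kernel
  rw [hammingNorm, Finset.card_filter, Fintype.sum_option]
  simp only [golayOctad_some, h]
  simp [golayOctad, golayWord_none]

/-- The octads `golayOctad k` for `k < 12`, restricted to the coordinates `11, …, 22`, form a
triangular matrix with ones on the diagonal. -/
theorem twelve_le_finrank_golayCode : 12 ≤ Module.finrank (ZMod 2) golayCode := by
  let M : Matrix (Fin 12) (Fin 12) (ZMod 2) :=
    fun k l => golayOctad (k.val : ZMod 23) (some (11 + l.val : ZMod 23))
  have htri : ∀ k l : Fin 12, k < l → M k l = 0 := by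
    simp only [M, golayOctad_some]
    decide +kernel
  have hdiag : ∀ k : Fin 12, M k k = 1 := by
    simp only [M, golayOctad_some]
    decide +kernel
  have hdet : M.det ≠ 0 := by
    rw [Matrix.det_of_isLowerTriangular M fun k l hkl => htri k l hkl]
    simp [hdiag]
  have hM : LinearIndependent (ZMod 2) M.row := Matrix.linearIndependent_rows_of_det_ne_zero hdet
  have hli : LinearIndependent (ZMod 2)
      fun k : Fin 12 => (⟨golayOctad (k.val : ZMod 23), golayOctad_mem _⟩ : golayCode) :=
    LinearIndependent.of_comp ((LinearMap.funLeft (ZMod 2) (ZMod 2)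
      fun l : Fin 12 => some (11 + l.val : ZMod 23)).comp golayCode.subtype) hM
  simpa using hli.fintype_card_le_finrank

/-- The Golay code is self-orthogonal, hence of dimension at most half its length. -/
theorem finrank_golayCode_le_twelve : Module.finrank (ZMod 2) golayCode ≤ 12 := by
  let T := dotProductEquiv (ZMod 2) (Option (ZMod 23))
  have hle : golayCode.map T.toLinearMap ≤ golayCode.dualAnnihilator := by
    rintro _ ⟨x, hx, rfl⟩
    rw [Submodule.mem_dualAnnihilator]
    exact fun y hy => dotProduct_eq_zero_of_mem_golayCode hx hy
  have h1 := Submodule.finrank_mono hle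
  rw [LinearEquiv.finrank_map_eq] at h1
  have h2 := Subspace.finrank_add_finrank_dualAnnihilator_eq golayCode
  rw [Module.finrank_fintype_fun_eq_card, Fintype.card_option, ZMod.card] at h2
  omega

theorem isBinaryLinearCode_golayCode : IsBinaryLinearCode golayCode 24 12 8 := by
  refine ⟨by rw [Fintype.card_option, ZMod.card],
    finrank_golayCode_le_twelve.antisymm twelve_le_finrank_golayCode, ?_, ?_⟩
  · refine ⟨golayOctad 0, golayOctad_mem 0, 0, golayCode.zero_mem, ?_, ?_⟩
    · rw [← hammingNorm_pos_iff, hammingNorm_golayOctad]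
      norm_num
    · rw [hammingDist_zero_right, hammingNorm_golayOctad]
  · rintro _ ⟨x, hx, y, hy, hxy, rfl⟩
    have hmem : -x + y ∈ golayCode := golayCode.add_mem (golayCode.neg_mem hx) hy
    rw [hammingDist_eq_hammingNorm]
    have h1 : 0 < hammingNorm (-x + y) :=
      hammingNorm_pos_iff.2 fun h => hxy (neg_add_eq_zero.1 h)
    have h2 := four_dvd_hammingNorm_of_mem_golayCode hmem
    have h3 := hammingNorm_ne_four_of_mem_golayCode hmem
    omega

/-- The binary Golay code is a linear `[24, 12, 8]` code and is not `ℤ₄`-linear; moreover no binary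
linear `[24, 12, 8]` code, however it is presented, is `ℤ₄`-linear. -/
theorem theorem2p9 :
    IsBinaryLinearCode golayCode 24 12 8 ∧
    ¬ IsZ4Linear (golayCode : Set (Option (ZMod 23) → ZMod 2)) ∧
    ∀ {ι : Type*} [Fintype ι] (C : Submodule (ZMod 2) (ι → ZMod 2)),
      IsBinaryLinearCode C 24 12 8 → ¬ IsZ4Linear (C : Set (ι → ZMod 2)) :=
  ⟨isBinaryLinearCode_golayCode,
    not_isZ4Linear_of_isBinaryLinearCode golayCode isBinaryLinearCode_golayCode,
    fun C hC => not_isZ4Linear_of_isBinaryLinearCode C hC⟩
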